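/- Let $\operatorname{sinc}(\alpha)=\frac{\sin(\pi\alpha)}{\pi\alpha}$ for $\alpha\neq0$ and $\operatorname{sinc}(0)=1$, and let $PW_\pi$ be the Paley–Wiener space of all (complex-valued) $f\in L^2(\mathbb R)$ whose Fourier transform $\mathcal F f(\xi)=\int_{\mathbb R}f(t)e^{-i\xi t}\,dt$ (in the $L^2$ sense) is supported in $[-\pi,\pi]$. A sequence in a Hilbert space $H$ is a Riesz basis for $H$ if it is the image of an orthonormal basis of $H$ under a bounded linear bijection of $H$ with bounded inverse. A sequence $\{f_n\}_{n\in\mathbb Z}$ in $H$ satisfies the Paley–Wiener criterion relative to an orthonormal basis $\{e_n\}_{n\in\mathbb Z}$ of $H$ if there is a constant $0\le q<1$ such that $\bigl\|\sum_{n\in S}a_n(e_n-f_n)\bigr\|\le q\bigl(\sum_{n\in S}|a_n|^2\bigr)^{1/2}$ for every finite $S\subset\mathbb Z$ and all complex scalars $a_n$. (i) Let $\{\lambda_n\}_{n\in\mathbb Z}$ be a sequence of real numbers and $L$ a real number with $|\lambda_n-n|\le L$ for all $n\in\mathbb Z$. If $L<\frac14$, then $\{\operatorname{sinc}(n-t)\}_{n\in\mathbb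 Z}$ is an orthonormal basis of $PW_\pi$ (for the inner product $\int_{\mathbb R}f\bar g\,dt$), the sequence $\{\operatorname{sinc}(\lambda_n-t)\}_{n\in\mathbb Z}$ satisfies the Paley–Wiener criterion relative to it, and $\{\operatorname{sinc}(\lambda_n-t)\}_{n\in\mathbb Z}$ is a Riesz basis for $PW_\pi$. (ii) The constant $\frac14$ is optimal, and $L=\frac14$ is not allowed: for the sequence $\lambda_n=n+\frac14$ $(n>0)$, $\lambda_0=0$, $\lambda_n=n-\frac14$ $(n<0)$, one has $|\lambda_n-n|\le\frac14$ for all $n\in\mathbb Z$, but $\{\operatorname{sinc}(\lambda_n-t)\}_{n\in\mathbb Z}$ is not a Riesz basis for $PW_\pi$. -/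

import Mathlib

open MeasureTheory Set FourierTransform

namespace SincSystem

noncomputable section

/-- The normalized sinc function: `sin (π α) / (π α)` for `α ≠ 0`, and `1` for `α = 0`. -/
def nsinc (α : ℝ) : ℝ :=
  if α = 0 then 1 else Real.sin (Real.pi * α) / (Real.pi * α)

theorem nsinc_eq_sinc (α : ℝ) : nsinc α = Real.sinc (Real.pi * α) := by
  unfold nsinc Real.sinc
  simp [Real.pi_ne_zero]

/-- Complex-valued `L²(ℝ)` with respect to Lebesgue measure. -/
abbrev L2R : Type := Lp ℂ 2 (volume : Measure ℝ)

/-- The Paley–Wiener space `PW_π`: the functions in `L²(ℝ)` whose (Plancherel) Fourier transform,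
in the convention `F f (ξ) = ∫ f t * exp (- i ξ t) dt`, is supported in `[-π, π]`.
The transform `𝓕` has kernel `exp (- 2 π i w t)`, so that `F f (2 π w) = 𝓕 f w`. -/
def PW : Submodule ℂ L2R where
  carrier := {f | ∀ᵐ w : ℝ, 2 * Real.pi * w ∉ Icc (-Real.pi) Real.pi → (𝓕 f : L2R) w = 0}
  zero_mem' := by
    have h : (𝓕 (0 : L2R) : L2R) = 0 := map_zero (Lp.fourierTransformₗᵢ ℝ ℂ)
    rw [mem_ofPred_eq, h]
    filter_upwards [Lp.coeFn_zero ℂ 2 (volume : Measure ℝ)] with w hw _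
    exact hw
  add_mem' := by
    intro f g hf hg
    have h : (𝓕 (f + g) : L2R) = 𝓕 f + 𝓕 g := map_add (Lp.fourierTransformₗᵢ ℝ ℂ) f g
    rw [mem_ofPred_eq, h]
    filter_upwards [hf, hg, Lp.coeFn_add (𝓕 f : L2R) (𝓕 g : L2R)] with w h1 h2 h3 hw
    rw [h3, Pi.add_apply, h1 hw, h2 hw, add_zero]
  smul_mem' := by
    intro c f hf
    have h : (𝓕 (c • f) : L2R) = c • 𝓕 f := map_smul (Lp.fourierTransformₗᵢ ℝ ℂ) c f
    rw [mem_ofPred_eq, h]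
    filter_upwards [hf, Lp.coeFn_smul c (𝓕 f : L2R)] with w h1 h3 hw
    rw [h3, Pi.smul_apply, h1 hw, smul_zero]

theorem mem_PW_iff (f : L2R) : f ∈ PW ↔
    ∀ᵐ w : ℝ, 2 * Real.pi * w ∉ Icc (-Real.pi) Real.pi → (𝓕 f : L2R) w = 0 :=
  Iff.rfl

theorem continuous_nsinc : Continuous nsinc := by
  have h : nsinc = fun α => Real.sinc (Real.pi * α) := funext nsinc_eq_sinc
  rw [h]
  exact Real.continuous_sinc.comp (by fun_prop)

theorem nsinc_sq_le (α : ℝ) : nsinc α ^ 2 ≤ 2 * (1 + α ^ 2)⁻¹ := by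
  have h1 : nsinc α ^ 2 ≤ 1 := by
    rw [nsinc_eq_sinc]
    exact (sq_le_one_iff_abs_le_one _).2 (Real.abs_sinc_le_one _)
  have h2 : α ^ 2 * nsinc α ^ 2 ≤ 1 := by
    by_cases h : α = 0
    · simp [h]
    · have h3 : α ^ 2 * nsinc α ^ 2 = Real.sin (Real.pi * α) ^ 2 / Real.pi ^ 2 := by
        have := Real.pi_ne_zero
        rw [nsinc, if_neg h]
        field_simp
      rw [h3, div_le_one (by positivity)]
      nlinarith [Real.sin_sq_le_one (Real.pi * α), Real.pi_gt_three]
  rw [← div_eq_mul_inv, le_div_iff₀ (by positivity)]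
  linarith

/-- The function `t ↦ sinc (μ - t)`, complex-valued. -/
def sincFun (μ : ℝ) : ℝ → ℂ := fun t => (nsinc (μ - t) : ℂ)

theorem memLp_sincFun (μ : ℝ) : MemLp (sincFun μ) 2 (volume : Measure ℝ) := by
  have hc : Continuous (sincFun μ) :=
    Complex.continuous_ofReal.comp (continuous_nsinc.comp (by fun_prop))
  rw [memLp_two_iff_integrable_sq_norm hc.aestronglyMeasurable]
  have hi : Integrable (fun t : ℝ => 2 * (1 + (μ - t) ^ 2)⁻¹) :=
    (integrable_inv_one_add_sq.comp_sub_left μ).const_mul 2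
  refine hi.mono' (by fun_prop) (Filter.Eventually.of_forall fun t => ?_)
  simpa [sincFun] using nsinc_sq_le (μ - t)

/-- The Fourier transform of `t ↦ sinc (μ - t)`. -/
def sincHat (μ : ℝ) : ℝ → ℂ :=
  (Icc (-(1 / 2) : ℝ) (1 / 2)).indicator
    (fun w => Complex.exp (-(2 * Real.pi * μ * w : ℝ) * Complex.I))

theorem memLp_sincHat (μ : ℝ) (p : ENNReal) : MemLp (sincHat μ) p (volume : Measure ℝ) := by
  refine MemLp.of_bound (μ := volume.restrict (Icc (-(1 / 2) : ℝ) (1 / 2)))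
    (f := fun w : ℝ => Complex.exp (-(2 * Real.pi * μ * w : ℝ) * Complex.I))
    (Continuous.aestronglyMeasurable (by fun_prop)) 1
    (Filter.Eventually.of_forall fun w => ?_) |> (memLp_indicator_iff_restrict measurableSet_Icc).2
  rw [← Complex.ofReal_neg, Complex.norm_exp_ofReal_mul_I]

theorem fourierInv_sincHat (μ t : ℝ) : 𝓕⁻ (sincHat μ) t = sincFun μ t := by
  have h1 : 𝓕⁻ (sincHat μ) t =
      ∫ w in (-(1 / 2) : ℝ)..(1 / 2), Complex.exp (2 * Real.pi * (t - μ) * Complex.I * w) := by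
    rw [Real.fourierInv_eq', intervalIntegral.integral_of_le (by norm_num),
      ← integral_Icc_eq_integral_Ioc, ← integral_indicator measurableSet_Icc]
    congr 1
    ext w
    by_cases hw : w ∈ Icc (-(1 / 2) : ℝ) (1 / 2)
    · simp only [sincHat, indicator_of_mem hw, smul_eq_mul, ← Complex.exp_add]
      congr 1
      simp
      ring
    · simp only [sincHat, indicator_of_notMem hw, smul_zero]
  rw [h1]
  by_cases h : μ - t = 0
  · have h' : t = μ := by linarith
    subst h'
    simp [sincFun, nsinc]
    norm_num
  · have hc : 2 * Real.pi * (t - μ) * Complex.I ≠ 0 := by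
      have : ((t : ℂ) - μ) ≠ 0 := by
        rw [← Complex.ofReal_sub]
        exact_mod_cast fun h0 => h (by linarith)
      simp [this, Real.pi_ne_zero]
    rw [integral_exp_mul_complex hc, sincFun, nsinc, if_neg h]
    have hpi : (Real.pi : ℂ) ≠ 0 := by exact_mod_cast Real.pi_ne_zero
    have hmt : (μ : ℂ) - t ≠ 0 := by
      rw [← Complex.ofReal_sub]
      exact_mod_cast h
    push_cast
    rw [Complex.sin, div_eq_div_iff hc (mul_ne_zero hpi hmt)]
    have e1 : 2 * (Real.pi : ℂ) * (t - μ) * Complex.I * (1 / 2)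
        = -(Real.pi * (μ - t)) * Complex.I := by ring
    have e2 : 2 * (Real.pi : ℂ) * (t - μ) * Complex.I * (-(1 / 2))
        = Real.pi * (μ - t) * Complex.I := by ring
    rw [e1, e2]
    linear_combination (Complex.exp (-(Real.pi * (μ - t)) * Complex.I)
      - Complex.exp (Real.pi * (μ - t) * Complex.I)) * (Real.pi * (μ - t)) * Complex.I_sq

theorem fourier_toLp_sincFun (μ : ℝ) :
    (𝓕 ((memLp_sincFun μ).toLp (sincFun μ) : L2R) : L2R)
      = (memLp_sincHat μ 2).toLp (sincHat μ) := by
  have key : ((memLp_sincFun μ).toLp (sincFun μ) : L2R)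
      = 𝓕⁻ ((memLp_sincHat μ 2).toLp (sincHat μ) : L2R) := by
    have hinj : Function.Injective (Lp.toTemperedDistributionCLM ℂ (volume : Measure ℝ) 2) :=
      LinearMap.ker_eq_bot.1 Lp.ker_toTemperedDistributionCLM_eq_bot
    apply hinj
    simp only [Lp.toTemperedDistributionCLM_apply]
    rw [← Lp.fourierInv_toTemperedDistribution_eq]
    ext φ
    rw [TemperedDistribution.fourierInv_apply, Lp.toTemperedDistribution_apply,
      Lp.toTemperedDistribution_apply]
    have e1 : ∫ x, φ x • ((memLp_sincFun μ).toLp (sincFun μ) : L2R) x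
        = ∫ x, φ x • 𝓕⁻ (sincHat μ) x := by
      apply integral_congr_ae
      filter_upwards [(memLp_sincFun μ).coeFn_toLp] with x hx
      rw [hx, fourierInv_sincHat]
    have e2 : ∫ x, (𝓕⁻ φ) x • ((memLp_sincHat μ 2).toLp (sincHat μ) : L2R) x
        = ∫ x, 𝓕⁻ (φ : ℝ → ℂ) x • sincHat μ x := by
      apply integral_congr_ae
      filter_upwards [(memLp_sincHat μ 2).coeFn_toLp] with x hx
      rw [hx, SchwartzMap.fourierInv_coe]
    rw [e1, e2]
    have := VectorFourier.integral_fourierIntegral_smul_eq_flip (L := -innerₗ ℝ)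
      (μ := (volume : Measure ℝ)) (ν := (volume : Measure ℝ))
      Real.continuous_fourierChar (by simp; fun_prop)
      (φ.integrable (μ := volume)) (memLp_one_iff_integrable.1 (memLp_sincHat μ 1))
    have hL : (-innerₗ ℝ : ℝ →ₗ[ℝ] ℝ →ₗ[ℝ] ℝ).flip = -innerₗ ℝ := by
      ext
      simp
    rw [hL] at this
    exact this.symm
  rw [key, fourier_fourierInv_eq]

/-- The function `t ↦ sinc (μ - t)` as an element of `PW_π`. -/
def sincPW (μ : ℝ) : PW :=
  ⟨(memLp_sincFun μ).toLp (sincFun μ), by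
    rw [mem_PW_iff, fourier_toLp_sincFun]
    filter_upwards [(memLp_sincHat μ 2).coeFn_toLp] with w hw hmem
    rw [hw, sincHat, indicator_of_notMem]
    intro h
    apply hmem
    have := Real.pi_pos
    constructor
    · nlinarith [h.1]
    · nlinarith [h.2]⟩

/-- A Riesz basis of a Hilbert space: the image of an orthonormal basis under a bounded linear
bijection with bounded inverse. -/
def IsRieszBasis {ι H : Type*} [NormedAddCommGroup H] [InnerProductSpace ℂ H] (x : ι → H) :
    Prop :=
  ∃ (e : HilbertBasis ι ℂ H) (T : H ≃L[ℂ] H), ∀ i, x i = T (e i)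

/-- The Paley–Wiener criterion for `f` relative to `e`: the family `e` is an orthonormal basis and
there is a constant `0 ≤ q < 1` with `‖∑ aᵢ (eᵢ - fᵢ)‖ ≤ q √(∑ |aᵢ|²)` for all finite choices of
scalars. -/
def PaleyWienerCriterion {ι H : Type*} [NormedAddCommGroup H] [InnerProductSpace ℂ H]
    (e f : ι → H) : Prop :=
  (∃ b : HilbertBasis ι ℂ H, ∀ i, b i = e i) ∧
    ∃ q : ℝ, 0 ≤ q ∧ q < 1 ∧ ∀ (s : Finset ι) (a : ι → ℂ),
      ‖∑ i ∈ s, a i • (e i - f i)‖ ≤ q * Real.sqrt (∑ i ∈ s, ‖a i‖ ^ 2)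

/-- The sequence `n + 1/4` for `n > 0`, `0` for `n = 0`, and `n - 1/4` for `n < 0`. -/
def inghamSeq (n : ℤ) : ℝ :=
  if 0 < n then (n : ℝ) + 1 / 4 else if n = 0 then 0 else (n : ℝ) - 1 / 4

end

end SincSystem

/-! By Plancherel, `sincPW μ` corresponds to the character `w ↦ exp (-2πiμw)` on `[-1/2, 1/2]`, so
every norm becomes an `L²` norm of an exponential sum (`norm_sum_smul_sincPW`), and the integer
system is the usual Fourier basis.

The positive half is a form of Kadec's argument. Write `exp (-2πiλₙw) = exp (-2πinw) · exp
(-2πiδₙw)` with `δₙ = λₙ - n`. Put `v = w + 1/2 ∈ [0, 1]`, extend the last factor evenly to `[-1,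
1]`, and expand `1 - foldExp δ v` in a 2-periodic Fourier series with coefficients `c_k(δ)`.
Interchanging sums writes the perturbation as a series over `k` of unimodular functions times
orthogonal sums with coefficients `aₙ c_k(δₙ)`. Minkowski then gives the constant `∑ₖ sup_{|δ| ≤ L}
|c_k(δ)|`. The supremum is attained at `L`, where each coefficient is nonnegative or `-i` times a
nonnegative number. Its modulus is thus `re - im`, and the series at `v = 0` sums to `1 - cos πL +
sin πL`, which is below `1` exactly because `L < 1/4`. A Neumann series turns the criterion into a
Riesz basis.

For the counterexample, a Riesz basis would bound `∑ |aₙ|²` by the squared norm of the combination.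
Take the coefficients of `(1 + z)^(-1/2)`, damped by `rⁿ`, on the positive indices and their
negatives on the negative ones. The resulting sum is `2i` times the imaginary part of nearly `Z =
exp (-πiw/2) (1 + r exp (-2πiw))^(-1/2)`. As `r → 1`, `Z²` tends to the positive function `1 / (2
cos πw)`, so `Im Z` is small and the norms stay bounded (`sq_norm_sum_ingham_le`). The squared
coefficients, however, dominate a harmonic series (`one_le_four_mul_sq_halfChoose`). -/

namespace SincSystem

/-! ### Perturbations of orthonormal bases in an abstract Hilbert space -/

section Abstract

variable {ι H : Type*} [NormedAddCommGroup H] [InnerProductSpace ℂ H]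

theorem sq_sum_norm_repr_le (b : HilbertBasis ι ℂ H) (x : H) (s : Finset ι) :
    ∑ i ∈ s, ‖b.repr x i‖ ^ 2 ≤ ‖x‖ ^ 2 := by
  simpa only [b.repr_apply_apply] using b.orthonormal.sum_inner_products_le x (s := s)

theorem summable_sq_norm_repr (b : HilbertBasis ι ℂ H) (x : H) :
    Summable fun i => ‖b.repr x i‖ ^ 2 :=
  summable_of_sum_le (fun _ => by positivity) (sq_sum_norm_repr_le b x)

/-- Families with a finite Bessel bound have convergent `ℓ²` combinations. -/
theorem summable_smul_of_bessel [CompleteSpace H] {g : ι → H} {q : ℝ}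
    (hq : 0 ≤ q) (hg : ∀ (s : Finset ι) (a : ι → ℂ),
      ‖∑ i ∈ s, a i • g i‖ ≤ q * Real.sqrt (∑ i ∈ s, ‖a i‖ ^ 2))
    {a : ι → ℂ} (ha : Summable fun i => ‖a i‖ ^ 2) : Summable fun i => a i • g i := by
  rw [summable_iff_vanishing_norm]
  intro ε hε
  obtain ⟨s, hs⟩ := summable_iff_vanishing_norm.1 ha ((ε / (q + 1)) ^ 2) (by positivity)
  refine ⟨s, fun t ht => (hg t a).trans_lt ?_⟩
  have h1 := hs t ht
  rw [Real.norm_of_nonneg (by positivity)] at h1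
  have h2 : Real.sqrt (∑ i ∈ t, ‖a i‖ ^ 2) < ε / (q + 1) :=
    (Real.sqrt_lt' (by positivity)).2 h1
  calc q * Real.sqrt (∑ i ∈ t, ‖a i‖ ^ 2) ≤ q * (ε / (q + 1)) := by gcongr
    _ < ε := by
      rw [mul_div_assoc', div_lt_iff₀ (by positivity)]
      nlinarith

/-- A family close to an orthonormal basis in the sense of Paley and Wiener is a Riesz basis. -/
theorem PaleyWienerCriterion.isRieszBasis [CompleteSpace H] {e f : ι → H}
    (h : PaleyWienerCriterion e f) : IsRieszBasis f := by
  obtain ⟨⟨b, hb⟩, q, hq0, hq1, hq⟩ := h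
  have hsum (x : H) : Summable fun i => b.repr x i • (e i - f i) :=
    summable_smul_of_bessel hq0 hq (summable_sq_norm_repr b x)
  let K₀ : H →ₗ[ℂ] H :=
    { toFun := fun x => ∑' i, b.repr x i • (e i - f i)
      map_add' := fun x y => by
        rw [← (hsum x).tsum_add (hsum y)]
        simp [add_smul]
      map_smul' := fun c x => by
        rw [RingHom.id_apply, ← (hsum x).tsum_const_smul]
        simp [mul_smul] }
  have hK₀ (x : H) : ‖K₀ x‖ ≤ q * ‖x‖ := by
    refine le_of_tendsto (hsum x).hasSum.norm (Filter.Eventually.of_forall fun s => ?_)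
    refine (hq s _).trans ?_
    gcongr
    exact Real.sqrt_le_iff.2 ⟨norm_nonneg _, sq_sum_norm_repr_le b x s⟩
  let K : H →L[ℂ] H := K₀.mkContinuous q hK₀
  have hK : ‖K‖ < 1 := (LinearMap.mkContinuous_norm_le _ hq0 _).trans_lt hq1
  -- `K` sends each basis vector to its perturbation `e i - f i`, so `1 - K` sends `e i` to `f i`;
  -- the Neumann series inverts it.
  obtain ⟨u, hu⟩ := isUnit_one_sub_of_norm_lt_one hK
  refine ⟨b, ContinuousLinearEquiv.ofUnit u, fun i => ?_⟩
  have h1 : ContinuousLinearEquiv.ofUnit u (b i) = (1 - K) (b i) := by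
    rw [← hu]; rfl
  have h2 : K (b i) = e i - f i := by
    change ∑' j, b.repr (b i) j • (e j - f j) = _
    classical
    rw [tsum_eq_single i]
    · simp [HilbertBasis.repr_self]
    · intro j hj
      rw [b.repr_self, lp.single_apply_ne _ _ _ hj, zero_smul]
  rw [h1, sub_apply, h2, ← hb i]
  simp

/-- The lower Riesz bound. -/
theorem IsRieszBasis.exists_sum_sq_le {f : ι → H} (h : IsRieszBasis f) {κ : Type*} {φ : κ → ι}
    (hφ : Function.Injective φ) : ∃ C : ℝ, 0 ≤ C ∧ ∀ (s : Finset κ) (a : κ → ℂ),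
      ∑ k ∈ s, ‖a k‖ ^ 2 ≤ C * ‖∑ k ∈ s, a k • f (φ k)‖ ^ 2 := by
  obtain ⟨b, T, hT⟩ := h
  refine ⟨‖(T.symm : H →L[ℂ] H)‖ ^ 2, by positivity, fun s a => ?_⟩
  have h1 : ∑ k ∈ s, a k • f (φ k) = T (∑ k ∈ s, a k • b (φ k)) := by simp [hT]
  have h2 : ‖∑ k ∈ s, a k • b (φ k)‖ ^ 2 = ∑ k ∈ s, ‖a k‖ ^ 2 := by
    have := (b.orthonormal.comp φ hφ).inner_sum a a s
    rw [← inner_self_eq_norm_sq (𝕜 := ℂ)]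
    simp only [Function.comp_apply] at this
    rw [this]
    simp [Complex.conj_mul', ← Complex.ofReal_pow]
  have h3 := (T.symm : H →L[ℂ] H).le_opNorm (∑ k ∈ s, a k • f (φ k))
  rw [h1] at h3
  rw [← h2, ← mul_pow, h1]
  gcongr
  simpa using h3

end Abstract

/-! ### The Paley–Wiener space on the Fourier side -/

/-- The space is the kernel of a continuous map: Fourier transform, then restriction to the
complement of the band. Closedness supplies the completeness needed for the Neumann series. -/
theorem isClosed_PW : IsClosed (PW : Set L2R) := by
  set s : Set ℝ := {w | 2 * Real.pi * w ∉ Icc (-Real.pi) Real.pi} with hs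
  have hms : MeasurableSet s :=
    ((measurableSet_Icc).preimage (by fun_prop : Measurable fun w : ℝ => 2 * Real.pi * w)).compl
  have : (PW : Set L2R) = (fun f : L2R =>
      LpToLpRestrictCLM ℝ ℂ ℂ volume 2 s (Lp.fourierTransformₗᵢ ℝ ℂ f)) ⁻¹' {0} := by
    ext f
    rw [SetLike.mem_coe, mem_PW_iff, mem_preimage, mem_singleton_iff, Lp.eq_zero_iff_ae_eq_zero]
    have h := LpToLpRestrictCLM_coeFn ℂ s (Lp.fourierTransformₗᵢ ℝ ℂ f : L2R)
    have h0 : (∀ᵐ w : ℝ, 2 * Real.pi * w ∉ Icc (-Real.pi) Real.pi → (𝓕 f : L2R) w = 0) ↔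
        ∀ᵐ w ∂volume.restrict s, (𝓕 f : L2R) w = 0 := (ae_restrict_iff' hms).symm
    rw [h0]
    constructor
    · intro h1
      filter_upwards [h, h1] with w h2 h3
      rw [h2]; exact h3
    · intro h1
      filter_upwards [h, h1] with w h2 h3
      rw [h3] at h2; exact h2.symm
  rw [this]
  refine isClosed_singleton.preimage ?_
  exact (ContinuousLinearMap.continuous _).comp (LinearIsometryEquiv.continuous _)

instance : CompleteSpace PW := isClosed_PW.completeSpace_coe

/-- The character `w ↦ exp (-2 π i μ w)`. -/
noncomputable def expChar (μ w : ℝ) : ℂ := Complex.exp (-(2 * Real.pi * μ * w : ℝ) * Complex.I)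

theorem norm_expChar (μ w : ℝ) : ‖expChar μ w‖ = 1 := by
  rw [expChar, ← Complex.ofReal_neg, Complex.norm_exp_ofReal_mul_I]

theorem continuous_expChar (μ : ℝ) : Continuous (expChar μ) := by
  unfold expChar; fun_prop

theorem expChar_add (μ ν w : ℝ) : expChar (μ + ν) w = expChar μ w * expChar ν w := by
  rw [expChar, expChar, expChar, ← Complex.exp_add]
  push_cast; ring_nf

theorem expChar_zero (w : ℝ) : expChar 0 w = 1 := by simp [expChar]

theorem conj_expChar (μ w : ℝ) : (starRingEnd ℂ) (expChar μ w) = expChar (-μ) w := by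
  rw [expChar, expChar, ← Complex.exp_conj]
  simp [map_ofNat]

/-- Plancherel. The index type is arbitrary and `μ` need not be injective, so that differences can
be treated as one sum over a doubled index set. -/
theorem norm_sum_smul_sincPW {ι : Type*} (s : Finset ι) (a : ι → ℂ) (μ : ι → ℝ) :
    ‖∑ i ∈ s, a i • sincPW (μ i)‖ = (eLpNorm (fun w => ∑ i ∈ s, a i * expChar (μ i) w) 2
      (volume.restrict (Icc (-(1 / 2) : ℝ) (1 / 2)))).toReal := by
  have h1 : ‖∑ i ∈ s, a i • sincPW (μ i)‖ =
      ‖(𝓕 ((∑ i ∈ s, a i • sincPW (μ i) : PW) : L2R) : L2R)‖ := by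
    rw [Lp.norm_fourier_eq]; rfl
  have h2 : (𝓕 ((∑ i ∈ s, a i • sincPW (μ i) : PW) : L2R) : L2R) =
      ∑ i ∈ s, a i • (memLp_sincHat (μ i) 2).toLp (sincHat (μ i)) := by
    rw [Submodule.coe_sum]
    refine (map_sum (Lp.fourierTransformₗᵢ ℝ ℂ) _ s).trans (Finset.sum_congr rfl fun i _ => ?_)
    rw [← fourier_toLp_sincFun]
    exact map_smul (Lp.fourierTransformₗᵢ ℝ ℂ) (a i) _
  rw [h1, h2, Lp.norm_def, ← eLpNorm_indicator_eq_eLpNorm_restrict measurableSet_Icc]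
  congr 1
  apply eLpNorm_congr_ae
  have h3 : ∀ᵐ w : ℝ, ∀ i ∈ s, ((a i • (memLp_sincHat (μ i) 2).toLp (sincHat (μ i)) : L2R) : ℝ → ℂ) w
      = a i * sincHat (μ i) w := by
    rw [Finset.eventually_all]
    intro i _
    filter_upwards [(memLp_sincHat (μ i) 2).coeFn_toLp,
      Lp.coeFn_smul (a i) ((memLp_sincHat (μ i) 2).toLp (sincHat (μ i)))] with w h4 h5
    rw [h5, Pi.smul_apply, h4, smul_eq_mul]
  filter_upwards [h3, Lp.coeFn_finsetSum s
    fun i => a i • (memLp_sincHat (μ i) 2).toLp (sincHat (μ i))] with w h4 h5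
  rw [h5, Finset.sum_apply, Finset.sum_congr rfl h4]
  by_cases hw : w ∈ Icc (-(1 / 2) : ℝ) (1 / 2)
  · simp only [indicator_of_mem hw, sincHat, expChar]
  · simp only [indicator_of_notMem hw, sincHat, mul_zero, Finset.sum_const_zero]

theorem inner_sincPW (μ : ℝ) (f : PW) : inner ℂ (sincPW μ) f =
    ∫ w in (-(1 / 2) : ℝ)..(1 / 2), expChar (-μ) w * (𝓕 (f : L2R) : L2R) w := by
  have h1 : inner ℂ (sincPW μ) f = inner ℂ (𝓕 (sincPW μ : L2R) : L2R) (𝓕 (f : L2R) : L2R) := by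
    rw [Lp.inner_fourier_eq]; rfl
  rw [h1, L2.inner_def, intervalIntegral.integral_of_le (by norm_num),
    ← integral_Icc_eq_integral_Ioc, ← integral_indicator measurableSet_Icc]
  apply integral_congr_ae
  have h2 : (𝓕 (sincPW μ : L2R) : L2R) = (memLp_sincHat μ 2).toLp (sincHat μ) :=
    fourier_toLp_sincFun μ
  rw [h2]
  filter_upwards [(memLp_sincHat μ 2).coeFn_toLp] with w hw
  rw [hw, RCLike.inner_apply', sincHat]
  by_cases h : w ∈ Icc (-(1 / 2) : ℝ) (1 / 2)
  · simp only [indicator_of_mem h]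
    rw [← conj_expChar]; rfl
  · simp only [indicator_of_notMem h, map_zero, zero_mul]

/-! ### The integer system as an orthonormal basis -/

theorem inner_sincPW_int (n : ℤ) (f : PW) : inner ℂ (sincPW n) f =
    fourierCoeffOn (by norm_num : (-(1 / 2) : ℝ) < 1 / 2) ((𝓕 (f : L2R) : L2R) : ℝ → ℂ) (-n) := by
  rw [inner_sincPW, fourierCoeffOn_eq_integral]
  have h : (1 / 2 - -(1 / 2) : ℝ) = 1 := by norm_num
  rw [h, one_div_one, one_smul]
  congr 1
  ext w
  rw [smul_eq_mul, fourier_coe_apply, expChar]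
  congr 2
  push_cast
  ring

theorem inner_sincPW_sincPW (m n : ℤ) :
    inner ℂ (sincPW m) (sincPW n) = if m = n then (1 : ℂ) else 0 := by
  have h1 : inner ℂ (sincPW m) (sincPW n) =
      ∫ w in (-(1 / 2) : ℝ)..(1 / 2), expChar (n - m) w := by
    rw [inner_sincPW, intervalIntegral.integral_of_le (by norm_num),
      intervalIntegral.integral_of_le (by norm_num)]
    have h2 : (𝓕 (sincPW n : L2R) : L2R) = (memLp_sincHat n 2).toLp (sincHat n) :=
      fourier_toLp_sincFun n
    rw [h2]
    apply setIntegral_congr_ae measurableSet_Ioc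
    filter_upwards [(memLp_sincHat n 2).coeFn_toLp] with w hw hmem
    rw [hw, sincHat, indicator_of_mem (Ioc_subset_Icc_self hmem), sub_eq_neg_add, expChar_add]
    rfl
  rw [h1]
  split_ifs with h
  · subst h
    simp [expChar_zero]
    norm_num
  · have hne : ((n : ℂ) - m) ≠ 0 := sub_ne_zero.2 (by exact_mod_cast Ne.symm h)
    have hc : -(2 * Real.pi * (n - m) * Complex.I) ≠ 0 := by
      simp [hne, Real.pi_ne_zero]
    have h3 : ∀ w : ℝ, expChar (n - m) w =
        Complex.exp (-(2 * Real.pi * (n - m) * Complex.I) * w) := by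
      intro w
      rw [expChar]; push_cast; ring_nf
    simp_rw [h3]
    rw [integral_exp_mul_complex hc, div_eq_zero_iff, sub_eq_zero]
    left
    rw [Complex.exp_eq_exp_iff_exists_int]
    refine ⟨m - n, ?_⟩
    push_cast; ring

theorem orthonormal_sincPW : Orthonormal ℂ fun n : ℤ => sincPW n := by
  rw [orthonormal_iff_ite]
  exact inner_sincPW_sincPW

/-- The inner products are all the Fourier coefficients of `𝓕 f` on an interval of length one, so
Parseval kills `𝓕 f` there, and band limitation kills it elsewhere. -/
theorem eq_zero_of_inner_sincPW {f : PW} (h : ∀ n : ℤ, inner ℂ (sincPW n) f = 0) : f = 0 := by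
  have hab : (-(1 / 2) : ℝ) < 1 / 2 := by norm_num
  have hL : MemLp ((𝓕 (f : L2R) : L2R) : ℝ → ℂ) 2 (volume.restrict (Ioc (-(1 / 2) : ℝ) (1 / 2))) :=
    (Lp.memLp _).restrict _
  have h1 := hasSum_sq_fourierCoeffOn hab hL
  have h2 : (fun i => ‖fourierCoeffOn hab ((𝓕 (f : L2R) : L2R) : ℝ → ℂ) i‖ ^ 2) = fun _ => 0 := by
    ext i
    have := inner_sincPW_int (-i) f
    rw [h, neg_neg] at this
    rw [← this]; simp
  rw [h2] at h1
  have h3 := h1.unique hasSum_zero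
  have h4 : ∫ x in Ioc (-(1 / 2) : ℝ) (1 / 2), ‖(𝓕 (f : L2R) : L2R) x‖ ^ 2 = 0 := by
    rw [← intervalIntegral.integral_of_le hab.le]
    norm_num at h3 ⊢
    exact h3
  rw [integral_eq_zero_iff_of_nonneg (fun _ => by positivity)
    ((memLp_two_iff_integrable_sq_norm hL.1).1 hL)] at h4
  have h5 := (ae_restrict_iff' measurableSet_Ioc).1 h4
  have h6 : (𝓕 (f : L2R) : L2R) = 0 := by
    rw [Lp.eq_zero_iff_ae_eq_zero]
    have hne : ∀ᵐ w : ℝ, w ≠ -(1 / 2) := by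
      simp [ae_iff]
    filter_upwards [h5, f.2, hne] with w h7 h8 h9
    by_cases hw : w ∈ Ioc (-(1 / 2) : ℝ) (1 / 2)
    · simpa using h7 hw
    · refine h8 fun h10 => hw ?_
      have := Real.pi_pos
      refine ⟨lt_of_le_of_ne ?_ (Ne.symm h9), ?_⟩
      · nlinarith [h10.1]
      · nlinarith [h10.2]
  have h7 : ‖f‖ = 0 := by
    have := Lp.norm_fourier_eq (f : L2R)
    rw [h6, norm_zero] at this
    exact this.symm
  exact norm_eq_zero.1 h7

/-- The integer translates of the sinc function, as a Hilbert basis of `PW_π`. -/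
noncomputable def sincBasis : HilbertBasis ℤ ℂ PW :=
  HilbertBasis.mkOfOrthogonalEqBot orthonormal_sincPW (by
    rw [Submodule.eq_bot_iff]
    intro f hf
    refine eq_zero_of_inner_sincPW fun n => ?_
    exact (Submodule.mem_orthogonal _ _).1 hf _ (Submodule.subset_span ⟨n, rfl⟩))

theorem sincBasis_apply (n : ℤ) : sincBasis n = sincPW n := by
  rw [sincBasis, HilbertBasis.coe_mkOfOrthogonalEqBot]

/-! ### Fourier expansion of the folded exponential -/

/-- The `2`-periodic Fourier coefficients of `v ↦ 1 - exp (i π δ (1 - 2 |v|))` on `[-1, 1]`. -/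
noncomputable def kadecCoeff (δ : ℝ) (n : ℤ) : ℂ :=
  if n = 0 then 1 - nsinc δ
  else if Even n then ((4 * δ * Real.sin (Real.pi * δ) / (Real.pi * (n ^ 2 - 4 * δ ^ 2)) : ℝ) : ℂ)
  else -Complex.I * ((4 * δ * Real.cos (Real.pi * δ) / (Real.pi * (n ^ 2 - 4 * δ ^ 2)) : ℝ) : ℂ)

/-- The function `v ↦ exp (i π δ (1 - 2 |v|))`. -/
noncomputable def foldExp (δ v : ℝ) : ℂ :=
  Complex.exp ((Real.pi * δ * (1 - 2 * |v|) : ℝ) * Complex.I)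

theorem continuous_foldExp (δ : ℝ) : Continuous (foldExp δ) := by
  unfold foldExp; fun_prop

theorem two_mul_ne_int {δ : ℝ} (hδ : |δ| < 1 / 4) {n : ℤ} (hn : n ≠ 0) :
    (n : ℝ) + 2 * δ ≠ 0 := by
  intro h
  have h1 : |(n : ℝ)| < 1 := by
    rw [show (n : ℝ) = -(2 * δ) by linarith, abs_neg, abs_mul, abs_two]; linarith
  exact hn (Int.abs_lt_one_iff.1 (by exact_mod_cast h1))

theorem integral_foldExp_eq (δ : ℝ) (n : ℤ) :
    ∫ x in (-1 : ℝ)..1, Complex.exp (-(Real.pi * n * x) * Complex.I) * foldExp δ x =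
      Complex.exp (Real.pi * δ * Complex.I) *
        ((∫ x in (0 : ℝ)..1, Complex.exp (-(Real.pi * (n + 2 * δ) * Complex.I) * x)) +
        ∫ x in (0 : ℝ)..1, Complex.exp (Real.pi * (n - 2 * δ) * Complex.I * x)) := by
  have hc : Continuous fun x : ℝ =>
      Complex.exp (-(Real.pi * n * x) * Complex.I) * foldExp δ x :=
    (by fun_prop : Continuous fun x : ℝ => Complex.exp (-(Real.pi * n * x) * Complex.I)).mul
      (continuous_foldExp δ)
  rw [← intervalIntegral.integral_add_adjacent_intervals (hc.intervalIntegrable (-1) 0)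
    (hc.intervalIntegrable 0 1), mul_add, add_comm]
  congr 1
  · rw [← intervalIntegral.integral_const_mul]
    apply intervalIntegral.integral_congr
    intro x hx
    rw [uIcc_of_le zero_le_one] at hx
    simp only [foldExp, abs_of_nonneg hx.1, ← Complex.exp_add]
    congr 1
    push_cast
    ring
  · rw [← intervalIntegral.integral_const_mul]
    have := intervalIntegral.integral_comp_neg (a := 0) (b := 1) (fun x : ℝ =>
      Complex.exp (-(Real.pi * n * x) * Complex.I) * foldExp δ x)
    rw [neg_zero] at this
    rw [← this]
    apply intervalIntegral.integral_congr
    intro x hx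
    rw [uIcc_of_le zero_le_one] at hx
    simp only [foldExp, abs_neg, abs_of_nonneg hx.1, ← Complex.exp_add]
    congr 1
    push_cast
    ring

theorem exp_pi_int_mul_I (n : ℤ) :
    Complex.exp (Real.pi * n * Complex.I) = if Even n then 1 else -1 := by
  rw [show (Real.pi : ℂ) * n * Complex.I = n * (Real.pi * Complex.I) by ring,
    Complex.exp_int_mul, Complex.exp_pi_mul_I]
  split_ifs with h
  · exact h.neg_one_zpow
  · exact (Int.not_even_iff_odd.1 h).neg_one_zpow

/-- Direct integration on the two halves of `[-1, 1]`. The antiderivatives have denominators `n ±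
2δ`, which vanish only for `n = δ = 0`; that case is separate. -/
theorem half_integral_foldExp {δ : ℝ} (hδ : |δ| < 1 / 4) (n : ℤ) :
    (1 / 2 : ℂ) * ∫ x in (-1 : ℝ)..1, Complex.exp (-(Real.pi * n * x) * Complex.I) * foldExp δ x =
      (if n = 0 then 1 else 0) - kadecCoeff δ n := by
  have hpi : (Real.pi : ℂ) ≠ 0 := by exact_mod_cast Real.pi_ne_zero
  by_cases h0 : n = 0 ∧ δ = 0
  · obtain ⟨rfl, rfl⟩ := h0
    simp [foldExp, kadecCoeff, nsinc]
    norm_num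
  have hp : ((n : ℂ) + 2 * δ) ≠ 0 := by
    by_cases hn : n = 0
    · have : δ ≠ 0 := fun h => h0 ⟨hn, h⟩
      simp [hn, this]
    · exact_mod_cast two_mul_ne_int hδ hn
  have hm : ((n : ℂ) - 2 * δ) ≠ 0 := by
    by_cases hn : n = 0
    · have : δ ≠ 0 := fun h => h0 ⟨hn, h⟩
      simp [hn, this]
    · have := two_mul_ne_int (δ := -δ) (by rwa [abs_neg]) hn
      rw [mul_neg, ← sub_eq_add_neg] at this
      exact_mod_cast this
  have e1 : -((Real.pi : ℂ) * (n + 2 * δ) * Complex.I) ≠ 0 := by simp [hpi, hp]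
  have e2 : (Real.pi : ℂ) * (n - 2 * δ) * Complex.I ≠ 0 := by simp [hpi, hm]
  rw [integral_foldExp_eq, integral_exp_mul_complex e1, integral_exp_mul_complex e2]
  simp only [Complex.ofReal_one, Complex.ofReal_zero, mul_one, mul_zero, Complex.exp_zero]
  set s : ℂ := if Even n then 1 else -1 with hs
  have hss : s * s = 1 := by rw [hs]; split_ifs <;> norm_num
  have hexp := exp_pi_int_mul_I n
  rw [← hs] at hexp
  have hexp' : Complex.exp (-(Real.pi * n * Complex.I)) = s := by
    rw [Complex.exp_neg, hexp, inv_eq_of_mul_eq_one_left hss]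
  set p := Complex.exp (Real.pi * δ * Complex.I) with hpdef
  set m := Complex.exp (-(Real.pi * δ * Complex.I)) with hmdef
  have hpm : p * m = 1 := by rw [hpdef, hmdef, ← Complex.exp_add, add_neg_cancel, Complex.exp_zero]
  have f1 : Complex.exp (-(Real.pi * (n + 2 * δ) * Complex.I)) = s * m * m := by
    rw [← hexp', hmdef, ← Complex.exp_add, ← Complex.exp_add]; ring_nf
  have f2 : Complex.exp (Real.pi * (n - 2 * δ) * Complex.I) = s * m * m := by
    rw [← hexp, hmdef, ← Complex.exp_add, ← Complex.exp_add]; ring_nf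
  rw [f1, f2]
  have key : (1 / 2 : ℂ) * (p * ((s * m * m - 1) / -(Real.pi * (n + 2 * δ) * Complex.I) +
      (s * m * m - 1) / (Real.pi * (n - 2 * δ) * Complex.I))) =
      (p - s * m) / (2 * Complex.I) * (-4 * δ) / (Real.pi * ((n + 2 * δ) * (n - 2 * δ))) := by
    have : p * (s * m * m - 1) = s * m - p := by linear_combination s * m * hpm
    field_simp
    linear_combination (4 * δ) * this
  rw [key]
  have hsin : (Real.sin (Real.pi * δ) : ℂ) = (p - m) / (2 * Complex.I) := by
    push_cast
    rw [Complex.sin, hpdef, hmdef]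
    field_simp
    rw [Complex.I_sq]; ring_nf
  have hcos : (Real.cos (Real.pi * δ) : ℂ) = (p + m) / 2 := by
    push_cast
    rw [Complex.cos, hpdef, hmdef, neg_mul]
  rw [kadecCoeff]
  by_cases hn : n = 0
  · have hδ0 : δ ≠ 0 := fun h => h0 ⟨hn, h⟩
    have hδc : (δ : ℂ) ≠ 0 := by exact_mod_cast hδ0
    have hs1 : s = 1 := by simp [hs, hn]
    rw [if_pos hn, if_pos hn, nsinc, if_neg hδ0, Complex.ofReal_div, hsin, hs1, hn]
    push_cast
    field_simp
    ring
  · have hd : ((n : ℂ) ^ 2 - 4 * δ ^ 2) = (n + 2 * δ) * (n - 2 * δ) := by ring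
    rw [if_neg hn, if_neg hn]
    split_ifs with h
    · have hs1 : s = 1 := by simp [hs, h]
      rw [Complex.ofReal_div, Complex.ofReal_mul (4 * δ), hsin, hs1]
      push_cast
      rw [hd]
      field_simp
      ring
    · have hs1 : s = -1 := by simp [hs, h]
      rw [Complex.ofReal_div, Complex.ofReal_mul (4 * δ), hcos, hs1]
      push_cast
      rw [hd]
      field_simp
      linear_combination (-(4 : ℂ) * δ * (p + m)) * Complex.I_sq

theorem norm_kadecCoeff_le {δ : ℝ} (hδ : |δ| < 1 / 4) {n : ℤ} (hn : n ≠ 0) :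
    ‖kadecCoeff δ n‖ ≤ 4 / (n : ℝ) ^ 2 := by
  have hn1 : (1 : ℝ) ≤ (n : ℝ) ^ 2 := by
    have : 1 ≤ n ^ 2 := Int.add_one_le_iff.2 (by positivity : 0 < n ^ 2)
    exact_mod_cast this
  have hδ2 : δ ^ 2 ≤ 1 / 16 := by
    rw [← sq_abs]; nlinarith [abs_nonneg δ]
  have hpi := Real.pi_gt_three
  have hbound (x : ℝ) (hx : |x| ≤ 1) :
      |4 * δ * x / (Real.pi * (n ^ 2 - 4 * δ ^ 2))| ≤ 4 / (n : ℝ) ^ 2 := by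
    have hpos : 0 < Real.pi * (n ^ 2 - 4 * δ ^ 2) := mul_pos (by linarith) (by linarith)
    rw [abs_div, abs_of_pos hpos, div_le_div_iff₀ hpos (by linarith), abs_mul, abs_mul,
      abs_of_nonneg (by norm_num : (0 : ℝ) ≤ 4)]
    have h1 : 4 * |δ| * |x| ≤ 1 := by nlinarith [abs_nonneg δ, abs_nonneg x]
    have h2 : 3 * ((n : ℝ) ^ 2 - 4 * δ ^ 2) ≤ Real.pi * (n ^ 2 - 4 * δ ^ 2) := by
      apply mul_le_mul_of_nonneg_right hpi.le; linarith
    nlinarith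
  rw [kadecCoeff, if_neg hn]
  split_ifs
  · rw [Complex.norm_real]
    exact hbound _ (Real.abs_sin_le_one _)
  · rw [norm_mul, norm_neg, Complex.norm_I, one_mul, Complex.norm_real]
    exact hbound _ (Real.abs_cos_le_one _)

theorem summable_kadecCoeff {δ : ℝ} (hδ : |δ| < 1 / 4) : Summable (kadecCoeff δ) := by
  have h1 : Summable fun n : ℤ => (4 : ℝ) / n ^ 2 := by
    have := (Real.summable_one_div_int_pow (p := 2)).2 (by norm_num)
    simpa [div_eq_mul_inv] using this.mul_left 4
  refine Summable.of_norm_bounded_eventually h1 ?_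
  have : ({0} : Set ℤ)ᶜ ∈ (Filter.cofinite : Filter ℤ) := (finite_singleton 0).compl_mem_cofinite
  filter_upwards [this] with n hn
  exact norm_kadecCoeff_le hδ hn

/-- The even extension agrees at `±1`, so it is continuous on the circle of length `2`. Its
coefficients are `O(n⁻²)`, so the Fourier series converges pointwise to it. -/
theorem hasSum_kadecCoeff {δ v : ℝ} (hδ : |δ| < 1 / 4) (hv : v ∈ Ico (-1 : ℝ) 1) :
    HasSum (fun n : ℤ => kadecCoeff δ n * Complex.exp (Real.pi * n * v * Complex.I))
      (1 - foldExp δ v) := by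
  have : Fact ((0 : ℝ) < 2) := ⟨by norm_num⟩
  have hcont : Continuous (AddCircle.liftIco (2 : ℝ) (-1) (foldExp δ)) := by
    apply AddCircle.liftIco_continuous
    · norm_num [foldExp]
    · exact (continuous_foldExp δ).continuousOn
  let f : C(AddCircle (2 : ℝ), ℂ) := ⟨_, hcont⟩
  have hcoeff (n : ℤ) : fourierCoeff f n = (if n = 0 then 1 else 0) - kadecCoeff δ n := by
    rw [← half_integral_foldExp hδ]
    change fourierCoeff (AddCircle.liftIco (2 : ℝ) (-1) (foldExp δ)) n = _
    rw [fourierCoeff_liftIco_eq, fourierCoeffOn_eq_integral, Complex.real_smul]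
    norm_num
    apply intervalIntegral.integral_congr
    intro x _
    simp only
    congr 1
    rw [← Complex.exp_conj]
    simp [map_ofNat]
    ring_nf
  have hite : HasSum (fun n : ℤ => if n = 0 then (1 : ℂ) else 0) 1 := hasSum_ite_eq 0 1
  have hsummable : Summable (fourierCoeff f) := by
    rw [funext hcoeff]
    exact hite.summable.sub (summable_kadecCoeff hδ)
  have h := has_pointwise_sum_fourier_series_of_summable hsummable (v : AddCircle (2 : ℝ))
  have hfv : f (v : AddCircle (2 : ℝ)) = foldExp δ v :=
    AddCircle.liftIco_coe_apply (p := 2) (a := -1) (f := foldExp δ) ⟨hv.1, by linarith [hv.2]⟩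
  rw [hfv] at h
  convert! hite.sub h using 2 with n
  rw [hcoeff, fourier_coe_apply, smul_eq_mul]
  have : Complex.exp (2 * Real.pi * Complex.I * n * v / (2 : ℝ)) =
      Complex.exp (Real.pi * n * v * Complex.I) := by
    push_cast; ring_nf
  rw [this]
  split_ifs with hn
  · simp [hn]
  · ring

/-! ### Monotonicity of the coefficients in the displacement -/

theorem nsinc_neg (x : ℝ) : nsinc (-x) = nsinc x := by
  rw [nsinc_eq_sinc, nsinc_eq_sinc, mul_neg, Real.sinc_neg]

theorem nsinc_le_one (x : ℝ) : nsinc x ≤ 1 := by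
  rw [nsinc_eq_sinc]
  exact (le_abs_self _).trans (Real.abs_sinc_le_one _)

/-- Concavity of `sin` on `[0, π]` makes its chord slopes from the origin decrease. -/
theorem nsinc_antitone {x y : ℝ} (hx : 0 ≤ x) (hxy : x ≤ y) (hy : y ≤ 1) : nsinc y ≤ nsinc x := by
  rcases hx.eq_or_lt with rfl | hx
  · simpa [nsinc] using nsinc_le_one y
  have hy0 : 0 < y := hx.trans_le hxy
  have hpi := Real.pi_pos
  have h := strictConcaveOn_sin_Icc.concaveOn.2 (⟨le_rfl, hpi.le⟩ : (0 : ℝ) ∈ Icc 0 Real.pi)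
    (⟨by positivity, by nlinarith⟩ : Real.pi * y ∈ Icc 0 Real.pi)
    (by rw [sub_nonneg, div_le_one hy0]; exact hxy : 0 ≤ 1 - x / y)
    (by positivity : 0 ≤ x / y) (by ring)
  have h1 : x / y * (Real.pi * y) = Real.pi * x := by field_simp
  simp only [smul_eq_mul, Real.sin_zero, mul_zero, zero_add, h1] at h
  rw [nsinc, nsinc, if_neg hx.ne', if_neg hy0.ne', div_le_div_iff₀ (by positivity) (by positivity)]
  have h2 : x / y * Real.sin (Real.pi * y) * (Real.pi * y) ≤
      Real.sin (Real.pi * x) * (Real.pi * y) := by gcongr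
  calc Real.sin (Real.pi * y) * (Real.pi * x)
      = x / y * Real.sin (Real.pi * y) * (Real.pi * y) := by field_simp
    _ ≤ _ := h2

theorem sin_le_cos_of_le_pi_div_four {x : ℝ} (h0 : 0 ≤ x) (hx : x ≤ Real.pi / 4) :
    Real.sin x ≤ Real.cos x := by
  have hpi := Real.pi_pos
  rw [← Real.sin_pi_div_two_sub]
  exact Real.sin_le_sin_of_le_of_le_pi_div_two (by linarith) (by linarith) (by linarith)

theorem monotoneOn_mul_cos : MonotoneOn (fun x => x * Real.cos (Real.pi * x)) (Icc 0 (1 / 4)) := by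
  have hpi := Real.pi_pos
  have hd (x : ℝ) : HasDerivAt (fun x => x * Real.cos (Real.pi * x))
      (Real.cos (Real.pi * x) - Real.pi * x * Real.sin (Real.pi * x)) x := by
    convert! (hasDerivAt_id x).mul (((hasDerivAt_id x).const_mul Real.pi).cos) using 1
    simp only [id]
    ring
  refine monotoneOn_of_deriv_nonneg (convex_Icc _ _)
    (fun x _ => (hd x).continuousAt.continuousWithinAt)
    (fun x _ => (hd x).differentiableAt.differentiableWithinAt) fun x hx => ?_
  rw [interior_Icc] at hx
  rw [(hd x).deriv]
  have h1 : Real.pi * x ≤ Real.pi / 4 := by nlinarith [hx.2]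
  have h0 : 0 ≤ Real.pi * x := by nlinarith [hx.1]
  have h2 := sin_le_cos_of_le_pi_div_four h0 h1
  have h3 : 0 ≤ Real.sin (Real.pi * x) := Real.sin_nonneg_of_nonneg_of_le_pi h0 (by linarith)
  have h4 : Real.pi * x ≤ 1 := by linarith [Real.pi_lt_four]
  nlinarith

theorem norm_kadecCoeff_neg (δ : ℝ) (n : ℤ) : ‖kadecCoeff (-δ) n‖ = ‖kadecCoeff δ n‖ := by
  rw [kadecCoeff, kadecCoeff, nsinc_neg]
  split_ifs
  · rfl
  · simp
  · simp [neg_div]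

theorem norm_kadecCoeff_abs (δ : ℝ) (n : ℤ) : ‖kadecCoeff |δ| n‖ = ‖kadecCoeff δ n‖ := by
  rcases abs_choice δ with h | h <;> rw [h]
  exact norm_kadecCoeff_neg δ n

/-- At `L ≥ 0` each coefficient is nonnegative or `-i` times a nonnegative number, so the right side
is its modulus, in a form linear in the coefficient and hence summable in closed form. The modulus
increases with `|δ|`: for `n ≠ 0`, `x sin πx` and `x cos πx` increase on `[0, 1/4]` while `n² - 4x²`
decreases; for `n = 0`, `1 - nsinc` increases. -/
theorem norm_kadecCoeff_le_re_sub_im {δ L : ℝ} (hδ : |δ| ≤ L) (hL : L < 1 / 4) (n : ℤ) :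
    ‖kadecCoeff δ n‖ ≤ (kadecCoeff L n).re - (kadecCoeff L n).im := by
  have hpi := Real.pi_pos
  rw [← norm_kadecCoeff_abs]
  have h0 := abs_nonneg δ
  generalize |δ| = d at hδ h0
  by_cases hn : n = 0
  · have h1 := nsinc_antitone h0 hδ (by linarith)
    have h2 := nsinc_le_one d
    have e (x : ℝ) : kadecCoeff x n = ((1 - nsinc x : ℝ) : ℂ) := by
      rw [kadecCoeff, if_pos hn]; push_cast; rfl
    rw [e, e, Complex.norm_real, Complex.ofReal_re, Complex.ofReal_im, Real.norm_of_nonneg] <;>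
      linarith
  have hn1 : (1 : ℝ) ≤ (n : ℝ) ^ 2 := by
    have : 1 ≤ n ^ 2 := Int.add_one_le_iff.2 (by positivity : 0 < n ^ 2)
    exact_mod_cast this
  have hpos (x : ℝ) (hx0 : 0 ≤ x) (hx : x < 1 / 4) : 0 < Real.pi * ((n : ℝ) ^ 2 - 4 * x ^ 2) :=
    mul_pos hpi (by nlinarith)
  have hdL : d < 1 / 4 := hδ.trans_lt hL
  have hL0 := h0.trans hδ
  have hden : Real.pi * ((n : ℝ) ^ 2 - 4 * L ^ 2) ≤ Real.pi * ((n : ℝ) ^ 2 - 4 * d ^ 2) := by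
    apply mul_le_mul_of_nonneg_left _ hpi.le
    nlinarith
  have hle : Real.pi * d ≤ Real.pi * L := by gcongr
  have hL2 : Real.pi * L ≤ Real.pi / 4 := by nlinarith
  by_cases hev : Even n
  · have e (x : ℝ) : kadecCoeff x n =
        ((4 * x * Real.sin (Real.pi * x) / (Real.pi * (n ^ 2 - 4 * x ^ 2)) : ℝ) : ℂ) := by
      rw [kadecCoeff, if_neg hn, if_pos hev]
    have hs : 0 ≤ Real.sin (Real.pi * d) :=
      Real.sin_nonneg_of_nonneg_of_le_pi (by positivity) (by linarith)
    have hm : Real.sin (Real.pi * d) ≤ Real.sin (Real.pi * L) :=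
      Real.sin_le_sin_of_le_of_le_pi_div_two (by nlinarith) (by linarith) hle
    rw [e, e, Complex.norm_real, Complex.ofReal_re, Complex.ofReal_im, sub_zero,
      Real.norm_of_nonneg (div_nonneg (by positivity) (hpos d h0 hdL).le)]
    apply div_le_div₀ (by have := hs.trans hm; positivity) _ (hpos L hL0 hL) hden
    gcongr
  · have e (x : ℝ) : kadecCoeff x n = -Complex.I *
        ((4 * x * Real.cos (Real.pi * x) / (Real.pi * (n ^ 2 - 4 * x ^ 2)) : ℝ) : ℂ) := by
      rw [kadecCoeff, if_neg hn, if_neg hev]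
    have hs (x : ℝ) (hx0 : 0 ≤ x) (hx : Real.pi * x ≤ Real.pi / 4) : 0 ≤ Real.cos (Real.pi * x) :=
      Real.cos_nonneg_of_neg_pi_div_two_le_of_le (by nlinarith) (by linarith)
    have hm := monotoneOn_mul_cos ⟨h0, hdL.le⟩ ⟨hL0, hL.le⟩ hδ
    simp only at hm
    have hd := hs d h0 (hle.trans hL2)
    have hc := hs L hL0 hL2
    rw [e, e, norm_mul, norm_neg, Complex.norm_I, one_mul, Complex.norm_real,
      Real.norm_of_nonneg (div_nonneg (by positivity) (hpos d h0 hdL).le)]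
    simp only [Complex.mul_re, Complex.mul_im, Complex.neg_re, Complex.neg_im, Complex.I_re,
      Complex.I_im, Complex.ofReal_re, Complex.ofReal_im]
    norm_num
    apply div_le_div₀ (by positivity) _ (hpos L hL0 hL) hden
    nlinarith

/-- At `v = 0` all exponentials are `1`, so the expansion sums the bare coefficients to `1 - exp
(iπL)`. -/
theorem hasSum_re_sub_im_kadecCoeff {L : ℝ} (hL : |L| < 1 / 4) :
    HasSum (fun n : ℤ => (kadecCoeff L n).re - (kadecCoeff L n).im)
      (1 - Real.cos (Real.pi * L) + Real.sin (Real.pi * L)) := by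
  have h := hasSum_kadecCoeff (v := 0) hL ⟨by norm_num, by norm_num⟩
  simp only [Complex.ofReal_zero, mul_zero, zero_mul, Complex.exp_zero, mul_one] at h
  convert! (Complex.hasSum_re h).sub (Complex.hasSum_im h) using 1
  simp only [foldExp, abs_zero, mul_zero, sub_zero, mul_one, Complex.sub_re, Complex.sub_im,
    Complex.one_re, Complex.one_im, Complex.exp_ofReal_mul_I_re, Complex.exp_ofReal_mul_I_im]
  ring

/-! ### The Paley–Wiener criterion below one quarter -/

/-- Minkowski's inequality for a pointwise convergent series of functions. -/
theorem eLpNorm_le_of_hasSum {α E : Type*} [MeasurableSpace α] {μ : Measure α}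
    [NormedAddCommGroup E] {p : ENNReal} (hp : 1 ≤ p) {g : ℕ → α → E} {F : α → E}
    {B : ℕ → ℝ} {q : ℝ} (hg : ∀ n, AEStronglyMeasurable (g n) μ)
    (hF : ∀ᵐ w ∂μ, HasSum (fun n => g n w) (F w)) (hB0 : ∀ n, 0 ≤ B n)
    (hB : ∀ n, eLpNorm (g n) p μ ≤ ENNReal.ofReal (B n)) (hq : HasSum B q) :
    eLpNorm F p μ ≤ ENNReal.ofReal q := by
  have h1 : eLpNorm F p μ ≤ Filter.atTop.liminf fun N =>
      eLpNorm (∑ n ∈ Finset.range N, g n) p μ := by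
    refine Lp.eLpNorm_lim_le_liminf_eLpNorm
      (fun N => Finset.aestronglyMeasurable_sum _ fun n _ => hg n) F ?_
    filter_upwards [hF] with w hw
    simpa only [Finset.sum_apply] using hw.tendsto_sum_nat
  refine h1.trans (Filter.liminf_le_of_frequently_le' (Filter.Frequently.of_forall fun N => ?_))
  calc eLpNorm (∑ n ∈ Finset.range N, g n) p μ ≤ ∑ n ∈ Finset.range N, eLpNorm (g n) p μ :=
        eLpNorm_sum_le (fun n _ => hg n) hp
    _ ≤ ∑ n ∈ Finset.range N, ENNReal.ofReal (B n) := Finset.sum_le_sum fun n _ => hB n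
    _ = ENNReal.ofReal (∑ n ∈ Finset.range N, B n) :=
        (ENNReal.ofReal_sum_of_nonneg fun n _ => hB0 n).symm
    _ ≤ ENNReal.ofReal q := ENNReal.ofReal_le_ofReal (sum_le_hasSum _ (fun n _ => hB0 n) hq)

theorem foldExp_add_half {δ w : ℝ} (hw : w ∈ Icc (-(1 / 2) : ℝ) (1 / 2)) :
    foldExp δ (w + 1 / 2) = expChar δ w := by
  rw [foldExp, expChar, abs_of_nonneg (by linarith [hw.1])]
  congr 1
  push_cast
  ring

theorem eLpNorm_sum_expChar_int (s : Finset ℤ) (a : ℤ → ℂ) :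
    eLpNorm (fun w => ∑ n ∈ s, a n * expChar n w) 2
      (volume.restrict (Icc (-(1 / 2) : ℝ) (1 / 2))) =
      ENNReal.ofReal (Real.sqrt (∑ n ∈ s, ‖a n‖ ^ 2)) := by
  have h1 : ‖∑ n ∈ s, a n • sincPW n‖ ^ 2 = ∑ n ∈ s, ‖a n‖ ^ 2 := by
    rw [← inner_self_eq_norm_sq (𝕜 := ℂ), orthonormal_sincPW.inner_sum a a s]
    simp [Complex.conj_mul', ← Complex.ofReal_pow]
  rw [← h1, Real.sqrt_sq (norm_nonneg _), norm_sum_smul_sincPW, ENNReal.ofReal_toReal]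
  refine (MemLp.of_bound (μ := volume.restrict (Icc (-(1 / 2) : ℝ) (1 / 2)))
    (Continuous.aestronglyMeasurable ?_) (∑ n ∈ s, ‖a n‖) ?_).2.ne
  · exact continuous_finsetSum _ fun n _ => continuous_const.mul (continuous_expChar n)
  · refine Filter.Eventually.of_forall fun w => (norm_sum_le _ _).trans (le_of_eq ?_)
    simp [norm_expChar]

theorem paleyWienerCriterion_sincPW {lam : ℤ → ℝ} {L : ℝ} (hlam : ∀ n : ℤ, |lam n - n| ≤ L)
    (hL : L < 1 / 4) :
    PaleyWienerCriterion (fun n : ℤ => sincPW n) (fun n : ℤ => sincPW (lam n)) := by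
  have hpi := Real.pi_pos
  have hL0 : 0 ≤ L := (abs_nonneg _).trans (hlam 0)
  set q : ℝ := 1 - Real.cos (Real.pi * L) + Real.sin (Real.pi * L)
  have hqsum := hasSum_re_sub_im_kadecCoeff (L := L) (by rwa [abs_of_nonneg hL0])
  have hB0 (n : ℤ) : 0 ≤ (kadecCoeff L n).re - (kadecCoeff L n).im :=
    (norm_nonneg _).trans (norm_kadecCoeff_le_re_sub_im (abs_of_nonneg hL0).le hL n)
  have hq0 : 0 ≤ q := hqsum.nonneg hB0
  -- This is `sin πL < cos πL`, that is `πL < π/4`: the only place where the value `1/4` is sharp.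
  have hq1 : q < 1 := by
    have h1 : Real.sin (Real.pi * L) < Real.cos (Real.pi * L) := by
      rw [← Real.sin_pi_div_two_sub]
      apply Real.sin_lt_sin_of_lt_of_le_pi_div_two <;> nlinarith
    linarith
  refine ⟨⟨sincBasis, sincBasis_apply⟩, q, hq0, hq1, fun s a => ?_⟩
  set A := Real.sqrt (∑ i ∈ s, ‖a i‖ ^ 2)
  set ν := volume.restrict (Icc (-(1 / 2) : ℝ) (1 / 2)) with hν
  have e1 : ‖∑ i ∈ s, a i • (sincPW i - sincPW (lam i))‖ =
      (eLpNorm (fun w => ∑ i ∈ s, a i * (expChar i w - expChar (lam i) w)) 2 ν).toReal := by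
    -- The difference is one exponential sum over two copies of `s`, with coefficients `a` and `-a`.
    have := norm_sum_smul_sincPW (s.disjSum s) (Sum.elim a (-a))
      (Sum.elim (fun i => (i : ℝ)) lam)
    simp only [Finset.sum_disjSum, Sum.elim_inl, Sum.elim_inr] at this
    simpa only [Pi.neg_apply, neg_smul, neg_mul, Finset.sum_neg_distrib, ← sub_eq_add_neg,
      ← Finset.sum_sub_distrib, ← smul_sub, ← mul_sub] using this
  rw [e1]
  refine ENNReal.toReal_le_of_le_ofReal (by positivity) ?_
  -- The `k`-th term after interchanging sums: a unimodular factor, which leaves the norm unchanged,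
  -- times a sum of orthonormal integer characters.
  let G : ℤ → ℝ → ℂ := fun k w => Complex.exp (Real.pi * k * (w + 1 / 2 : ℝ) * Complex.I) *
    ∑ i ∈ s, (a i * kadecCoeff (lam i - i) k) * expChar i w
  let σ : ℕ ≃ ℤ := (Denumerable.eqv ℤ).symm
  have hGm (k : ℤ) : Continuous (G k) := by
    refine Continuous.mul (by fun_prop) ?_
    exact continuous_finsetSum _ fun n _ => continuous_const.mul (continuous_expChar n)
  refine eLpNorm_le_of_hasSum (g := fun m => G (σ m)) one_le_two
    (B := fun m => ((kadecCoeff L (σ m)).re - (kadecCoeff L (σ m)).im) * A)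
    (fun m => (hGm _).aestronglyMeasurable) ?_ (fun m => mul_nonneg (hB0 _) (Real.sqrt_nonneg _))
    (fun m => ?_) ((σ.hasSum_iff.2 hqsum).mul_right A)
  -- The point `w = 1/2` gives `v = 1`, outside the half-open period on which the expansion is
  -- stated.
  · have hne : ∀ᵐ w : ℝ, w ≠ 1 / 2 := by simp [ae_iff]
    rw [hν, ae_restrict_iff' measurableSet_Icc]
    filter_upwards [hne] with w hw hmem
    refine σ.hasSum_iff (f := fun k => G k w) |>.2 ?_
    have hv : w + 1 / 2 ∈ Ico (-1 : ℝ) 1 :=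
      ⟨by linarith [hmem.1], by have := lt_of_le_of_ne hmem.2 hw; linarith⟩
    have h1 : HasSum (fun k : ℤ => ∑ i ∈ s, a i * expChar i w * (kadecCoeff (lam i - i) k *
        Complex.exp (Real.pi * k * (w + 1 / 2 : ℝ) * Complex.I)))
        (∑ i ∈ s, a i * expChar i w * (1 - foldExp (lam i - i) (w + 1 / 2))) :=
      hasSum_sum fun i _ => (hasSum_kadecCoeff ((hlam i).trans_lt hL) hv).mul_left _
    convert! h1 using 1
    · ext k
      simp only [G, Finset.mul_sum]
      refine Finset.sum_congr rfl fun i _ => by ring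
    · refine Finset.sum_congr rfl fun i _ => ?_
      have h2 : expChar (lam i) w = expChar i w * expChar (lam i - i) w := by
        rw [← expChar_add]; congr 1; ring
      rw [foldExp_add_half hmem, h2]
      ring
  · set k := σ m
    have h1 : eLpNorm (G k) 2 ν =
        eLpNorm (fun w => ∑ i ∈ s, (a i * kadecCoeff (lam i - i) k) * expChar i w) 2 ν := by
      refine eLpNorm_congr_norm_ae (Filter.Eventually.of_forall fun w => ?_)
      simp only [G]
      rw [norm_mul, show (Real.pi : ℂ) * k * (w + 1 / 2 : ℝ) = ((Real.pi * k * (w + 1 / 2) : ℝ) : ℂ)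
        by push_cast; ring, Complex.norm_exp_ofReal_mul_I, one_mul]
    rw [h1, eLpNorm_sum_expChar_int]
    apply ENNReal.ofReal_le_ofReal
    rw [Real.sqrt_le_left (mul_nonneg (hB0 _) (Real.sqrt_nonneg _)), mul_pow,
      Real.sq_sqrt (by positivity), Finset.mul_sum]
    refine Finset.sum_le_sum fun i _ => ?_
    rw [norm_mul, mul_pow, mul_comm]
    gcongr
    exact norm_kadecCoeff_le_re_sub_im (hlam i) hL k

/-! ### Failure at one quarter -/

/-- The binomial coefficients of `(1 + z) ^ (-1/2)`. -/
noncomputable def halfChoose (n : ℕ) : ℝ := Ring.choose (-1 / 2 : ℝ) n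

theorem halfChoose_zero : halfChoose 0 = 1 := Ring.choose_zero_right _

theorem halfChoose_succ (n : ℕ) :
    (n + 1) * halfChoose (n + 1) = -(n + 1 / 2) * halfChoose n := by
  have h1 := Ring.descPochhammer_eq_factorial_smul_choose (-1 / 2 : ℝ) (n + 1)
  rw [descPochhammer_succ_right, Polynomial.smeval_mul,
    Ring.descPochhammer_eq_factorial_smul_choose, Nat.factorial_succ] at h1
  have h2 : ((Polynomial.X : Polynomial ℤ) - (n : Polynomial ℤ)).smeval (-1 / 2 : ℝ) = -1 / 2 - n := by
    rw [Polynomial.smeval_sub, Polynomial.smeval_X, Polynomial.smeval_natCast]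
    simp
  rw [h2] at h1
  simp only [nsmul_eq_mul] at h1
  have hf : (n.factorial : ℝ) ≠ 0 := by positivity
  apply mul_left_cancel₀ hf
  unfold halfChoose
  push_cast at h1
  linear_combination -h1

theorem abs_halfChoose_le_one (n : ℕ) : |halfChoose n| ≤ 1 := by
  induction n with
  | zero => simp [halfChoose_zero]
  | succ n ih =>
    have h := congrArg abs (halfChoose_succ n)
    rw [abs_mul, abs_mul, abs_neg, abs_of_pos (by positivity : (0 : ℝ) < n + 1),
      abs_of_pos (by positivity : (0 : ℝ) < n + 1 / 2)] at h
    have hn : (0 : ℝ) ≤ n := n.cast_nonneg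
    by_contra! hc
    nlinarith

/-- Makes the squared coefficients non-summable. The induction rests on `(n + 3/2)² ≥ (n + 1)(n +
2)`, and equality holds at `n = 0`. -/
theorem one_le_four_mul_sq_halfChoose (n : ℕ) :
    1 ≤ 4 * (n + 1 : ℝ) * halfChoose (n + 1) ^ 2 := by
  induction n with
  | zero =>
    have h := halfChoose_succ 0
    rw [halfChoose_zero] at h
    norm_num at h ⊢
    rw [h]; norm_num
  | succ n ih =>
    have h := halfChoose_succ (n + 1)
    push_cast at h ⊢
    set x := halfChoose (n + 1)
    set y := halfChoose (n + 1 + 1)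
    have hn : (0 : ℝ) ≤ n := n.cast_nonneg
    have h2 : ((n : ℝ) + 1 + 1) ^ 2 * y ^ 2 = (n + 1 + 1 / 2) ^ 2 * x ^ 2 := by
      linear_combination ((n + 1 + 1) * y - (n + 1 + 1 / 2) * x) * h
    have h3 : ((n : ℝ) + 1 + 1) * 1 ≤ (n + 1 + 1) * (4 * (n + 1 + 1) * y ^ 2) := by
      nlinarith [sq_nonneg x]
    exact le_of_mul_le_mul_left h3 (by positivity)

theorem hasSum_halfChoose {z : ℂ} (hz : ‖z‖ < 1) :
    HasSum (fun n => (halfChoose n : ℂ) * z ^ n) ((1 + z) ^ (-1 / 2 : ℂ)) := by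
  have h := (Complex.one_add_cpow_hasFPowerSeriesOnBall_zero (a := (-1 / 2 : ℂ))).hasSum
    (y := z) (by
      rw [Metric.mem_eball, edist_zero_right, ← ofReal_norm, ENNReal.ofReal_lt_one]
      exact hz)
  convert! h using 2 with n
  · rw [binomialSeries_apply, halfChoose, Complex.ofReal_choose]
    simp
  · simp

theorem two_mul_sq_im (Z : ℂ) : 2 * Z.im ^ 2 = ‖Z ^ 2‖ - (Z ^ 2).re := by
  rw [norm_pow, Complex.sq_norm, Complex.normSq_apply, pow_two Z, Complex.mul_re]
  ring

theorem norm_inv_sub_re_inv_le {z : ℂ} (hz : 0 ≤ z.re) :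
    ‖z⁻¹‖ - z⁻¹.re ≤ |z.im| / Complex.normSq z := by
  by_cases h0 : z = 0
  · simp [h0]
  have hn : 0 < ‖z‖ := norm_pos_iff.2 h0
  have h := Complex.norm_le_abs_re_add_abs_im z
  rw [abs_of_nonneg hz] at h
  have e : ‖z‖⁻¹ = ‖z‖ / ‖z‖ ^ 2 := by field_simp
  rw [norm_inv, Complex.inv_re, Complex.normSq_eq_norm_sq, e, ← sub_div]
  gcongr
  linarith

theorem expChar_eq (μ w : ℝ) : expChar μ w =
    Real.cos (2 * Real.pi * μ * w) - Real.sin (2 * Real.pi * μ * w) * Complex.I := by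
  rw [expChar, ← Complex.ofReal_neg, Complex.exp_ofReal_mul_I]
  simp [sub_eq_add_neg]

/-- The square of the function is `z⁻¹` with `z = (1 + r) cos πw + i (1 - r) sin πw`, which lies in
the closed right half-plane and is nearly real. Now `2 (Im Z)² = |Z²| - Re Z²`, and `|z| - Re z ≤
|Im z|`. -/
theorem sq_im_binomial_le {r w : ℝ} (hr : 1 / 2 ≤ r) (hr1 : r < 1)
    (hw : w ∈ Icc (-(1 / 2) : ℝ) (1 / 2)) :
    (expChar (1 / 4) w * (1 + r * expChar 1 w) ^ (-1 / 2 : ℂ)).im ^ 2 ≤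
      (1 - r) * |Real.sin (Real.pi * w)| /
        (2 * ((1 - r) ^ 2 + Real.cos (Real.pi * w) ^ 2)) := by
  have hpi := Real.pi_pos
  set z : ℂ := expChar (-(1 / 2)) w + r * expChar (1 / 2) w with hz
  have hz0 : z = expChar (-(1 / 2)) w * (1 + r * expChar 1 w) := by
    have : expChar (1 / 2) w = expChar (-(1 / 2)) w * expChar 1 w := by
      rw [← expChar_add]; norm_num
    rw [hz, this]; ring
  have hne : (1 : ℂ) + r * expChar 1 w ≠ 0 := by
    intro h
    have h1 : ‖(r : ℂ) * expChar 1 w‖ = 1 := by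
      rw [eq_neg_of_add_eq_zero_right h]; simp
    rw [norm_mul, norm_expChar, Complex.norm_real, Real.norm_of_nonneg (by linarith)] at h1
    linarith
  have hsq : (expChar (1 / 4) w * (1 + r * expChar 1 w) ^ (-1 / 2 : ℂ)) ^ 2 = z⁻¹ := by
    rw [mul_pow, ← Complex.cpow_nat_mul, hz0, mul_inv, pow_two (expChar _ _), ← expChar_add]
    congr 1
    · apply eq_inv_of_mul_eq_one_left
      rw [← expChar_add]; norm_num [expChar_zero]
    · norm_num [Complex.cpow_neg_one]
  have e1 : 2 * Real.pi * (1 / 2) * w = Real.pi * w := by ring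
  have e2 : 2 * Real.pi * (-(1 / 2)) * w = -(Real.pi * w) := by ring
  have hzc : z = ((1 + r) * Real.cos (Real.pi * w) : ℝ) +
      ((1 - r) * Real.sin (Real.pi * w) : ℝ) * Complex.I := by
    rw [hz, expChar_eq, expChar_eq, e1, e2, Real.cos_neg, Real.sin_neg]
    push_cast; ring
  have hre : z.re = (1 + r) * Real.cos (Real.pi * w) := by
    rw [hzc]
    simp only [Complex.add_re, Complex.ofReal_re, Complex.re_ofReal_mul, Complex.I_re, mul_zero,
      add_zero]
  have him : z.im = (1 - r) * Real.sin (Real.pi * w) := by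
    rw [hzc]
    simp only [Complex.add_im, Complex.ofReal_im, Complex.im_ofReal_mul, Complex.I_im, mul_one,
      zero_add]
  have hcos : 0 ≤ Real.cos (Real.pi * w) :=
    Real.cos_nonneg_of_neg_pi_div_two_le_of_le (by nlinarith [hw.1]) (by nlinarith [hw.2])
  have hsc := Real.sin_sq_add_cos_sq (Real.pi * w)
  -- Here `|z|² = (1 - r)² + 4r cos² πw`, and `r ≥ 1/2` gives `4r ≥ 1`.
  have hnorm : (1 - r) ^ 2 + Real.cos (Real.pi * w) ^ 2 ≤ Complex.normSq z := by
    rw [Complex.normSq_apply, hre, him]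
    nlinarith [sq_nonneg (Real.cos (Real.pi * w))]
  have h := norm_inv_sub_re_inv_le (z := z) (by rw [hre]; positivity)
  rw [← hsq, ← two_mul_sq_im, him, abs_mul, abs_of_pos (by linarith : 0 < 1 - r)] at h
  have hpos : 0 < (1 - r) ^ 2 + Real.cos (Real.pi * w) ^ 2 := by
    have : 0 < 1 - r := by linarith
    positivity
  have h2 : (1 - r) * |Real.sin (Real.pi * w)| / Complex.normSq z ≤
      (1 - r) * |Real.sin (Real.pi * w)| / ((1 - r) ^ 2 + Real.cos (Real.pi * w) ^ 2) := by
    have : 0 < 1 - r := by linarith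
    gcongr
  rw [mul_comm (2 : ℝ), ← div_div]
  linarith

theorem continuous_poissonBound {ε : ℝ} (hε : 0 < ε) :
    Continuous fun w => ε * |Real.sin (Real.pi * w)| / (ε ^ 2 + Real.cos (Real.pi * w) ^ 2) := by
  refine Continuous.div (by fun_prop) (by fun_prop) fun w => ?_
  positivity

/-- The integrand is even, and on `[0, 1/2]` it has primitive `-arctan (cos πw / ε) / π`; the total
`2 arctan (1/ε) / π` is below `1` uniformly in `ε`. -/
theorem integral_poissonBound_le {ε : ℝ} (hε : 0 < ε) :
    ∫ w in (-(1 / 2) : ℝ)..(1 / 2),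
      ε * |Real.sin (Real.pi * w)| / (ε ^ 2 + Real.cos (Real.pi * w) ^ 2) ≤ 1 := by
  have hpi := Real.pi_pos
  have hc := continuous_poissonBound hε
  set g : ℝ → ℝ := fun w =>
    ε * |Real.sin (Real.pi * w)| / (ε ^ 2 + Real.cos (Real.pi * w) ^ 2) with hg
  have heven (w : ℝ) : g (-w) = g w := by simp [hg]
  have hneg : ∫ w in (-(1 / 2) : ℝ)..0, g w = ∫ w in (0 : ℝ)..(1 / 2), g w := by
    have := intervalIntegral.integral_comp_neg (a := 0) (b := 1 / 2) g
    rw [neg_zero] at this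
    rw [← this]
    simp only [heven]
  have hd (w : ℝ) : HasDerivAt (fun w => -(Real.arctan (Real.cos (Real.pi * w) / ε) / Real.pi))
      (ε * Real.sin (Real.pi * w) / (ε ^ 2 + Real.cos (Real.pi * w) ^ 2)) w := by
    convert! (((((hasDerivAt_id w).const_mul Real.pi).cos).div_const ε).arctan.div_const
      Real.pi).neg using 1
    have : ε ^ 2 + Real.cos (Real.pi * w) ^ 2 ≠ 0 := by positivity
    simp only [id]
    field_simp
  have hpos : ∫ w in (0 : ℝ)..(1 / 2), g w = Real.arctan (1 / ε) / Real.pi := by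
    have h1 : ∫ w in (0 : ℝ)..(1 / 2), g w = ∫ w in (0 : ℝ)..(1 / 2),
        ε * Real.sin (Real.pi * w) / (ε ^ 2 + Real.cos (Real.pi * w) ^ 2) := by
      apply intervalIntegral.integral_congr
      intro w hw
      rw [uIcc_of_le (by norm_num)] at hw
      simp only [hg]
      rw [abs_of_nonneg]
      exact Real.sin_nonneg_of_nonneg_of_le_pi (by nlinarith [hw.1]) (by nlinarith [hw.2])
    rw [h1, intervalIntegral.integral_eq_sub_of_hasDerivAt (fun w _ => hd w)]
    · simp [← div_eq_mul_inv]
    · refine (Continuous.div (by fun_prop) (by fun_prop) fun w => ?_).intervalIntegrable _ _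
      positivity
  rw [← intervalIntegral.integral_add_adjacent_intervals (hc.intervalIntegrable (-(1 / 2)) 0)
    (hc.intervalIntegrable 0 (1 / 2)), hneg, hpos, ← add_div, div_le_one hpi]
  linarith [Real.arctan_lt_pi_div_two (1 / ε)]

/-- The sum is `P - conj P`, of modulus `2 |Im P|`. `P` differs from `Z` by the omitted constant
term and the tail of the binomial series, each of modulus at most `1`. -/
theorem norm_sum_halfChoose_le {r w : ℝ} (hr : 1 / 2 ≤ r) (hr1 : r < 1) {N : ℕ}
    (hN : r ^ (N + 1) ≤ 1 - r) (hw : w ∈ Icc (-(1 / 2) : ℝ) (1 / 2)) :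
    ‖∑ n ∈ Finset.range N, ((halfChoose (n + 1) * r ^ (n + 1) : ℝ) : ℂ) *
        (expChar ((n + 1 : ℕ) + 1 / 4) w - expChar (-((n + 1 : ℕ) + 1 / 4)) w)‖ ^ 2 ≤
      4 * ((1 - r) * |Real.sin (Real.pi * w)| /
        ((1 - r) ^ 2 + Real.cos (Real.pi * w) ^ 2)) + 32 := by
  set ζ : ℂ := r * expChar 1 w with hζ
  have hζn : ‖ζ‖ = r := by
    rw [hζ, norm_mul, norm_expChar, Complex.norm_real, Real.norm_of_nonneg (by linarith), mul_one]
  have hpow (n : ℕ) : expChar (n + 1 / 4) w * (r : ℂ) ^ n = expChar (1 / 4) w * ζ ^ n := by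
    have : expChar 1 w ^ n = expChar n w := by
      rw [expChar, expChar, ← Complex.exp_nat_mul]
      congr 1; push_cast; ring
    rw [hζ, mul_pow, this, add_comm, expChar_add]; ring
  set P : ℂ := expChar (1 / 4) w * ∑ n ∈ Finset.range N, (halfChoose (n + 1) : ℂ) * ζ ^ (n + 1)
    with hP
  set Z : ℂ := expChar (1 / 4) w * (1 + ζ) ^ (-1 / 2 : ℂ) with hZ
  have h1 : ∑ n ∈ Finset.range N, ((halfChoose (n + 1) * r ^ (n + 1) : ℝ) : ℂ) *
      (expChar ((n + 1 : ℕ) + 1 / 4) w - expChar (-((n + 1 : ℕ) + 1 / 4)) w) =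
      P - (starRingEnd ℂ) P := by
    have h2 : P = ∑ n ∈ Finset.range N, ((halfChoose (n + 1) * r ^ (n + 1) : ℝ) : ℂ) *
        expChar ((n + 1 : ℕ) + 1 / 4) w := by
      rw [hP, Finset.mul_sum]
      refine Finset.sum_congr rfl fun n _ => ?_
      have := hpow (n + 1)
      push_cast at this ⊢
      linear_combination -(halfChoose (n + 1) : ℂ) * this
    rw [h2, map_sum, ← Finset.sum_sub_distrib]
    refine Finset.sum_congr rfl fun n _ => ?_
    rw [map_mul, Complex.conj_ofReal, conj_expChar, mul_sub]
  have h2 : ‖P - (starRingEnd ℂ) P‖ = 2 * |P.im| := by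
    rw [Complex.sub_conj, norm_mul, Complex.norm_I, mul_one, Complex.norm_real, Real.norm_eq_abs,
      abs_mul, abs_two]
  -- Since the binomial coefficients are bounded by `1`, the tail is at most `r^(N+1) / (1 - r)`,
  -- which `hN` keeps below `1`.
  have htail : ‖P + expChar (1 / 4) w - Z‖ ≤ 1 := by
    have h3 := norm_sub_le_of_geometric_bound_of_hasSum (C := 1) (r := r) hr1 (fun n => ?_)
      (hasSum_halfChoose (z := ζ) (by rwa [hζn])) (N + 1)
    · rw [Finset.sum_range_succ', halfChoose_zero, pow_zero, mul_one, Complex.ofReal_one,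
        one_mul] at h3
      have h4 : P + expChar (1 / 4) w - Z = expChar (1 / 4) w *
          (∑ n ∈ Finset.range N, (halfChoose (n + 1) : ℂ) * ζ ^ (n + 1) + 1 -
            (1 + ζ) ^ (-1 / 2 : ℂ)) := by
        rw [hP, hZ]; ring
      rw [h4, norm_mul, norm_expChar, one_mul]
      exact h3.trans ((div_le_one (by linarith)).2 hN)
    · rw [norm_mul, norm_pow, hζn, Complex.norm_real]
      gcongr
      exact abs_halfChoose_le_one n
  have h5 : |P.im| ≤ |Z.im| + 2 := by
    have h6 : P.im = Z.im + (P + expChar (1 / 4) w - Z).im - (expChar (1 / 4) w).im := by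
      simp only [Complex.add_im, Complex.sub_im]; ring
    have h7 := (Complex.abs_im_le_norm _).trans htail
    have h8 := (Complex.abs_im_le_norm _).trans (norm_expChar (1 / 4) w).le
    rw [h6]
    refine (abs_sub _ _).trans ?_
    have := abs_add_le Z.im (P + expChar (1 / 4) w - Z).im
    linarith
  have h9 := sq_im_binomial_le hr hr1 hw
  rw [mul_comm (2 : ℝ), ← div_div] at h9
  change Z.im ^ 2 ≤ _ at h9
  rw [h1, h2]
  -- Then `4 (x + 2)² ≤ 8x² + 32`, which gives the constants `4` and `32` of the statement.
  have h10 : (2 * |P.im|) ^ 2 ≤ (2 * (|Z.im| + 2)) ^ 2 := by gcongr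
  nlinarith [sq_abs Z.im, sq_nonneg (|Z.im| - 2)]

/-- The map enumerating the nonzero integers. -/
def nonzeroInt : ℕ ⊕ ℕ → ℤ := Sum.elim (fun n => (n : ℤ) + 1) fun n => -((n : ℤ) + 1)

theorem nonzeroInt_injective : Function.Injective nonzeroInt := by
  rintro (m | m) (n | n) h <;> simp only [nonzeroInt, Sum.elim_inl, Sum.elim_inr] at h
  · congr 1; omega
  · omega
  · omega
  · congr 1; omega

theorem inghamSeq_succ (n : ℕ) : inghamSeq ((n : ℤ) + 1) = (n + 1 : ℕ) + 1 / 4 := by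
  rw [inghamSeq, if_pos (by positivity)]
  push_cast; ring

theorem inghamSeq_neg_succ (n : ℕ) : inghamSeq (-((n : ℤ) + 1)) = -((n + 1 : ℕ) + 1 / 4) := by
  rw [inghamSeq, if_neg (by omega), if_neg (by omega)]
  push_cast; ring

theorem abs_inghamSeq_sub_le (n : ℤ) : |inghamSeq n - n| ≤ 1 / 4 := by
  unfold inghamSeq
  split_ifs with h1 h2
  · simp
  · simp [h2]
  · norm_num [abs_le]

theorem sq_norm_sum_ingham_le {r : ℝ} (hr : 1 / 2 ≤ r) (hr1 : r < 1) {N : ℕ}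
    (hN : r ^ (N + 1) ≤ 1 - r) :
    ‖∑ n ∈ Finset.range N, ((halfChoose (n + 1) * r ^ (n + 1) : ℝ) : ℂ) •
      (sincPW ((n + 1 : ℕ) + 1 / 4) - sincPW (-((n + 1 : ℕ) + 1 / 4)))‖ ^ 2 ≤ 36 := by
  set a : ℕ → ℂ := fun n => ((halfChoose (n + 1) * r ^ (n + 1) : ℝ) : ℂ)
  set μ : ℕ → ℝ := fun n => (n + 1 : ℕ) + 1 / 4
  set S : ℝ → ℂ := fun w => ∑ n ∈ Finset.range N, a n * (expChar (μ n) w - expChar (-μ n) w)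
    with hS
  set ν := volume.restrict (Icc (-(1 / 2) : ℝ) (1 / 2)) with hν
  have e1 : ‖∑ n ∈ Finset.range N, a n • (sincPW (μ n) - sincPW (-μ n))‖ =
      (eLpNorm S 2 ν).toReal := by
    have := norm_sum_smul_sincPW ((Finset.range N).disjSum (Finset.range N)) (Sum.elim a (-a))
      (Sum.elim μ (-μ))
    simp only [Finset.sum_disjSum, Sum.elim_inl, Sum.elim_inr] at this
    simpa only [Pi.neg_apply, neg_smul, neg_mul, Finset.sum_neg_distrib, ← sub_eq_add_neg,
      ← Finset.sum_sub_distrib, ← smul_sub, ← mul_sub] using this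
  have hSc : Continuous S := continuous_finsetSum _ fun n _ =>
    continuous_const.mul ((continuous_expChar _).sub (continuous_expChar _))
  have hSL : MemLp S 2 ν := by
    rw [memLp_two_iff_integrable_sq_norm hSc.aestronglyMeasurable]
    exact (by fun_prop : Continuous fun w => ‖S w‖ ^ 2).integrableOn_Icc
  have hε : 0 < 1 - r := by linarith
  have hc := continuous_poissonBound hε
  have e2 : (eLpNorm S 2 ν).toReal ^ 2 = ∫ w in (-(1 / 2) : ℝ)..(1 / 2), ‖S w‖ ^ 2 := by
    rw [hSL.eLpNorm_eq_integral_rpow_norm (by norm_num) (by norm_num), ENNReal.toReal_ofReal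
      (by positivity), intervalIntegral.integral_of_le (by norm_num),
      ← integral_Icc_eq_integral_Ioc]
    simp only [ENNReal.toReal_ofNat, Real.rpow_ofNat]
    rw [← Real.rpow_natCast, ← Real.rpow_mul (integral_nonneg fun _ => by positivity)]
    norm_num [hν]
  rw [e1, e2]
  calc ∫ w in (-(1 / 2) : ℝ)..(1 / 2), ‖S w‖ ^ 2
      ≤ ∫ w in (-(1 / 2) : ℝ)..(1 / 2), (4 * ((1 - r) * |Real.sin (Real.pi * w)| /
        ((1 - r) ^ 2 + Real.cos (Real.pi * w) ^ 2)) + 32) :=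
        intervalIntegral.integral_mono_on (by norm_num)
          ((by fun_prop : Continuous fun w => ‖S w‖ ^ 2).intervalIntegrable _ _)
          (((hc.const_mul 4).add continuous_const).intervalIntegrable _ _)
          fun w hw => norm_sum_halfChoose_le hr hr1 hN hw
    _ = 4 * (∫ w in (-(1 / 2) : ℝ)..(1 / 2), (1 - r) * |Real.sin (Real.pi * w)| /
        ((1 - r) ^ 2 + Real.cos (Real.pi * w) ^ 2)) + 32 := by
        rw [intervalIntegral.integral_add ((hc.const_mul 4).intervalIntegrable _ _)
          (continuous_const.intervalIntegrable _ _), intervalIntegral.integral_const_mul]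
        norm_num
    _ ≤ 36 := by linarith [integral_poissonBound_le hε]

theorem not_isRieszBasis_ingham : ¬ IsRieszBasis fun n : ℤ => sincPW (inghamSeq n) := by
  intro h
  obtain ⟨C, hC0, hC⟩ := h.exists_sum_sq_le nonzeroInt_injective
  have h1 (r : ℝ) (hr : 1 / 2 ≤ r) (hr1 : r < 1) (M : ℕ) :
      ∑ n ∈ Finset.range M, (halfChoose (n + 1) * r ^ (n + 1)) ^ 2 ≤ C * 36 := by
    obtain ⟨k, hk⟩ := exists_pow_lt_of_lt_one (by linarith : 0 < 1 - r) hr1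
    -- The norm bound needs a long truncation depending on `r`, while the sum of squares is wanted
    -- for fixed `M`; enlarging `M` to `N` only increases that sum.
    set N := max M k
    have hN : r ^ (N + 1) ≤ 1 - r :=
      (pow_le_pow_of_le_one (by linarith) hr1.le ((le_max_right M k).trans N.le_succ)).trans hk.le
    set a : ℕ → ℂ := fun n => ((halfChoose (n + 1) * r ^ (n + 1) : ℝ) : ℂ) with ha
    have h2 := hC ((Finset.range N).disjSum (Finset.range N)) (Sum.elim a (-a))
    simp only [Finset.sum_disjSum, Sum.elim_inl, Sum.elim_inr, nonzeroInt, inghamSeq_succ,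
      inghamSeq_neg_succ, Pi.neg_apply, neg_smul, norm_neg, Finset.sum_neg_distrib,
      ← sub_eq_add_neg, ← Finset.sum_sub_distrib, ← smul_sub] at h2
    have h3 := mul_le_mul_of_nonneg_left (sq_norm_sum_ingham_le hr hr1 hN) hC0
    have h4 (n : ℕ) : ‖a n‖ ^ 2 = (halfChoose (n + 1) * r ^ (n + 1)) ^ 2 := by
      rw [ha, Complex.norm_real, Real.norm_eq_abs, sq_abs]
    simp only [h4] at h2
    have h5 : ∑ n ∈ Finset.range M, (halfChoose (n + 1) * r ^ (n + 1)) ^ 2 ≤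
        ∑ n ∈ Finset.range N, (halfChoose (n + 1) * r ^ (n + 1)) ^ 2 :=
      Finset.sum_le_sum_of_subset_of_nonneg (Finset.range_mono (le_max_left M k))
        fun _ _ _ => by positivity
    have h6 : 0 ≤ ∑ n ∈ Finset.range N, (halfChoose (n + 1) * r ^ (n + 1)) ^ 2 :=
      Finset.sum_nonneg fun _ _ => by positivity
    linarith
  have h2 (M : ℕ) : ∑ n ∈ Finset.range M, halfChoose (n + 1) ^ 2 ≤ C * 36 := by
    -- The bound is uniform in `r`, so the damping is removed by letting `r` increase to `1` with
    -- `M` fixed.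
    have hcont : Continuous fun r : ℝ =>
        ∑ n ∈ Finset.range M, (halfChoose (n + 1) * r ^ (n + 1)) ^ 2 := by fun_prop
    have ht := (hcont.tendsto 1).mono_left (nhdsWithin_le_nhds (s := Iio 1))
    simp only [one_pow, mul_one] at ht
    refine le_of_tendsto ht ?_
    filter_upwards [Ico_mem_nhdsLT (by norm_num : (1 / 2 : ℝ) < 1)] with r hr
    exact h1 r hr.1 hr.2 M
  obtain ⟨M, hM⟩ := (Real.tendsto_sum_range_one_div_nat_succ_atTop.eventually_gt_atTop
    (4 * (C * 36))).exists
  have h3 : ∑ n ∈ Finset.range M, 1 / ((n : ℝ) + 1) ≤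
      4 * ∑ n ∈ Finset.range M, halfChoose (n + 1) ^ 2 := by
    rw [Finset.mul_sum]
    refine Finset.sum_le_sum fun n _ => ?_
    rw [div_le_iff₀ (by positivity)]
    linarith [one_le_four_mul_sq_halfChoose n]
  linarith [h2 M]

end SincSystem

theorem proposition1 :
    (∀ (lam : ℤ → ℝ) (L : ℝ), (∀ n : ℤ, |lam n - n| ≤ L) → L < 1 / 4 →
      SincSystem.PaleyWienerCriterion
          (fun n : ℤ => SincSystem.sincPW n) (fun n : ℤ => SincSystem.sincPW (lam n)) ∧
        SincSystem.IsRieszBasis (fun n : ℤ => SincSystem.sincPW (lam n))) ∧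
    ((∀ n : ℤ, |SincSystem.inghamSeq n - n| ≤ 1 / 4) ∧
      ¬ SincSystem.IsRieszBasis (fun n : ℤ => SincSystem.sincPW (SincSystem.inghamSeq n))) := by
  refine ⟨fun lam L hlam hL => ?_, SincSystem.abs_inghamSeq_sub_le,
    SincSystem.not_isRieszBasis_ingham⟩
  have h := SincSystem.paleyWienerCriterion_sincPW hlam hL
  exact ⟨h, h.isRieszBasis⟩
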